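/- Let $A$ and $B$ be self-adjoint operators in a complex Hilbert space $\mathcal H$ with $A\ge 1$ and $B\ge 1$, that is, $\langle x, Ax\rangle\ge\|x\|^2$ for all $x\in D(A)$, and likewise for $B$. Powers and products of operators are taken on their natural domains, $B^{-\ell}=(B^\ell)^{-1}$, and $\mathcal D^\infty(A)=\bigcap_{n\ge 1}D(A^n)$. An operator $T$ with domain $D(T)$ is called bounded if there is a constant $C$ with $\|Tx\|\le C\|x\|$ for all $x\in D(T)$. Consider the conditions (i) for each integer $k\ge 1$ there exists an integer $\ell\ge 1$ such that $A^kB^{-\ell}$ is bounded; (ii) for each integer $h\ge 1$ there exists an integer $m\ge 1$ such that $B^hA^{-m}$ is bounded. If $\mathcal D^\infty(A)=\mathcal D^\infty(B)$, then (i) and (ii) hold, and the exponents $\ell$ and $m$ can be chosen so that the bounded operators $A^kB^{-\ell}$ and $B^hA^{-m}$ are, moreover, defined on all of $\mathcal H$. Conversely, if $\mathcal D^\infty(A)\cap\mathcal D^\infty(B)$ contains a linear subspace $\mathcal D_0$ that is a core for $A^n$ and for $B^n$ for every $n\ge 1$, and if (i) and (ii) hold (boundedness being required only on the natural domains), then $\mathcal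 D^\infty(A)=\mathcal D^\infty(B)$. -/

import Mathlib

namespace UnboundedOp

noncomputable section

variable {H : Type*} [NormedAddCommGroup H] [InnerProductSpace ℂ H]

/-- The product `S T` of two unbounded operators, on its natural domain
`{x ∈ D(T) | T x ∈ D(S)}`. -/
def prod (S T : H →ₗ.[ℂ] H) : H →ₗ.[ℂ] H :=
  S.comp (T.domRestrict ((S.domain.comap T.toFun).map T.domain.subtype)) (by
    rintro ⟨_, ⟨y, hy, rfl⟩, hx⟩
    exact hy)

theorem mem_prod_domain {S T : H →ₗ.[ℂ] H} {x : H} :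
    x ∈ (prod S T).domain ↔ ∃ h : x ∈ T.domain, T ⟨x, h⟩ ∈ S.domain := by
  constructor
  · rintro ⟨⟨y, hy, rfl⟩, hx⟩
    exact ⟨hx, hy⟩
  · rintro ⟨h, h2⟩
    exact ⟨⟨⟨x, h⟩, h2, rfl⟩, h⟩

theorem prod_apply {S T : H →ₗ.[ℂ] H} {x : H} (hx : x ∈ (prod S T).domain)
    (h : x ∈ T.domain) (h2 : T ⟨x, h⟩ ∈ S.domain) :
    prod S T ⟨x, hx⟩ = S ⟨T ⟨x, h⟩, h2⟩ := rfl

/-- The powers of an unbounded operator: `T⁰ = I` on the whole space and `Tⁿ⁺¹ = T Tⁿ`,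
each on its natural domain. -/
def pow (T : H →ₗ.[ℂ] H) : ℕ → (H →ₗ.[ℂ] H)
  | 0 => (LinearMap.id : H →ₗ[ℂ] H).toPMap ⊤
  | n + 1 => prod T (pow T n)

/-- The negative power `T⁻ⁿ`, the inverse of `Tⁿ`, defined on the range of `Tⁿ`. -/
def negPow (T : H →ₗ.[ℂ] H) (n : ℕ) : H →ₗ.[ℂ] H :=
  (pow T n).inverse

/-- The space `D^∞(T) = ⋂_{n ≥ 1} D(Tⁿ)`. -/
def smoothDomain (T : H →ₗ.[ℂ] H) : Submodule ℂ H :=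
  ⨅ n : ℕ, ⨅ _ : 1 ≤ n, (pow T n).domain

/-- `T ≥ 1` in the sense of quadratic forms on `D(T)`. -/
def GeOne (T : H →ₗ.[ℂ] H) : Prop :=
  ∀ x : T.domain, ‖(x : H)‖ ^ 2 ≤ (inner ℂ (x : H) (T x)).re

/-- `T` is bounded on its domain (which need not be the whole space). -/
def IsBoundedOp (T : H →ₗ.[ℂ] H) : Prop :=
  ∃ C : ℝ, ∀ x : T.domain, ‖T x‖ ≤ C * ‖(x : H)‖

/-- `D₀` is a common core for all powers `Aⁿ` and `Bⁿ`, `n ≥ 1`. -/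
def IsCommonCore (A B : H →ₗ.[ℂ] H) (D₀ : Submodule ℂ H) : Prop :=
  ∀ n : ℕ, 1 ≤ n → (pow A n).HasCore D₀ ∧ (pow B n).HasCore D₀

end

end UnboundedOp

/-! Since `A, B ≥ 1`, the inverses `P = A⁻¹` and `Q = B⁻¹` are injective self-adjoint contractions,
and `D(Aⁿ) = ran Pⁿ`, `D(Bⁿ) = ran Qⁿ`. If `D^∞(B) ⊆ D^∞(A)`, a Baire argument on the Fréchet space
`D^∞(B)` (`exists_norm_inner_le`) bounds `⟨w, Q^N y⟩` by `C ‖y‖ ‖P^k w‖` for `y ∈ D^∞(B)`. As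
`D^∞(B)` is dense, this gives `Q^N = P^k V` with `V` bounded, and `V` is `A^k B^{-N}`. Conversely,
boundedness of `A^k B^{-l}` says `‖A^k x‖ ≤ C ‖B^l x‖`, which passes from the core to all of
`D(B^l)` because `A^k` is closed. -/

open Filter Topology

namespace UnboundedOp

variable {H : Type*} [NormedAddCommGroup H] [InnerProductSpace ℂ H]

/-! ### Powers and domains in terms of a bounded inverse -/

/-- `R` is an everywhere defined bounded operator inverse to `T`. -/
def IsBoundedInverse (T : H →ₗ.[ℂ] H) (R : H →L[ℂ] H) : Prop :=
  ∀ x y : H, (x, y) ∈ T.graph ↔ R y = x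

theorem mem_prod_graph {S T : H →ₗ.[ℂ] H} {x z : H} :
    (x, z) ∈ (prod S T).graph ↔ ∃ y, (x, y) ∈ T.graph ∧ (y, z) ∈ S.graph := by
  constructor
  · intro h
    obtain ⟨⟨x', hx'⟩, rfl, rfl⟩ := (LinearPMap.mem_graph_iff _).1 h
    obtain ⟨h1, h2⟩ := mem_prod_domain.1 hx'
    exact ⟨T ⟨x', h1⟩, T.mem_graph ⟨x', h1⟩, S.mem_graph ⟨_, h2⟩⟩
  · rintro ⟨y, h1, h2⟩
    obtain ⟨⟨x', hx'⟩, rfl, rfl⟩ := (LinearPMap.mem_graph_iff _).1 h1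
    obtain ⟨⟨y', hy'⟩, hy, rfl⟩ := (LinearPMap.mem_graph_iff _).1 h2
    dsimp only at hy
    subst hy
    exact (prod S T).mem_graph ⟨x', mem_prod_domain.2 ⟨hx', hy'⟩⟩

namespace IsBoundedInverse

variable {T : H →ₗ.[ℂ] H} {R : H →L[ℂ] H}

theorem pow (h : IsBoundedInverse T R) (n : ℕ) : IsBoundedInverse (pow T n) (R ^ n) := by
  induction n with
  | zero =>
    intro x y
    simp [UnboundedOp.pow, eq_comm]
  | succ n ih =>
    intro x z
    rw [UnboundedOp.pow, mem_prod_graph, pow_succ]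
    simp only [ih _ _, h _ _]
    exact ⟨by rintro ⟨y, rfl, rfl⟩; rfl, fun hx => ⟨R z, hx, rfl⟩⟩

theorem injective (h : IsBoundedInverse T R) : Function.Injective R := by
  intro y z hyz
  exact LinearPMap.mem_graph_snd_inj T ((h (R z) y).2 hyz) ((h _ _).2 rfl) rfl

theorem mem_domain_iff (h : IsBoundedInverse T R) {x : H} : x ∈ T.domain ↔ ∃ y, R y = x := by
  simp only [LinearPMap.mem_domain_iff, h x]

theorem mem_inverse_graph_iff (h : IsBoundedInverse T R) {x y : H} :
    (y, x) ∈ T.inverse.graph ↔ R y = x := by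
  have hker : LinearMap.ker T.toFun = ⊥ := by
    rw [LinearMap.ker_eq_bot']
    intro x hx
    have h1 := (h _ _).1 (T.mem_graph x)
    rw [show T x = 0 from hx, map_zero] at h1
    exact Subtype.ext h1.symm
  rw [LinearPMap.inverse_graph hker, ← h]
  simp [-LinearPMap.mem_graph_iff]

theorem isClosed (h : IsBoundedInverse T R) : T.IsClosed := by
  have : (T.graph : Set (H × H)) = {p | R p.2 = p.1} := by
    ext ⟨x, y⟩
    exact h x y
  rw [LinearPMap.IsClosed, this]
  exact isClosed_eq (by fun_prop) (by fun_prop)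

theorem mem_smoothDomain_iff (h : IsBoundedInverse T R) {x : H} :
    x ∈ smoothDomain T ↔ ∀ n, ∃ y, (R ^ n) y = x := by
  simp only [smoothDomain, Submodule.mem_iInf, (h.pow _).mem_domain_iff]
  exact ⟨fun hx n => n.casesOn ⟨x, rfl⟩ fun n => hx (n + 1) (by lia), fun hx n _ => hx n⟩

theorem smoothDomain_le (h : IsBoundedInverse T R) {S : H →ₗ.[ℂ] H}
    (hS : ∀ k, 1 ≤ k → ∃ l, (UnboundedOp.pow T l).domain ≤ (UnboundedOp.pow S k).domain) :
    smoothDomain T ≤ smoothDomain S := by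
  intro x hx
  simp only [smoothDomain, Submodule.mem_iInf]
  intro k hk
  obtain ⟨l, hl⟩ := hS k hk
  exact hl ((h.pow l).mem_domain_iff.2 (h.mem_smoothDomain_iff.1 hx l))

end IsBoundedInverse

/-! ### The bounded inverse of a self-adjoint `T ≥ 1` -/

section Existence

variable {T : H →ₗ.[ℂ] H}

theorem GeOne.norm_le (h : GeOne T) (x : T.domain) : ‖(x : H)‖ ≤ ‖T x‖ := by
  have h1 := h x
  have h2 : (inner ℂ (x : H) (T x)).re ≤ ‖(x : H)‖ * ‖T x‖ :=
    (Complex.re_le_norm _).trans (norm_inner_le_norm _ _)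
  by_contra! h3
  nlinarith [norm_nonneg (x : H), norm_nonneg (T x)]

theorem GeOne.exists_isBoundedInverse [CompleteSpace H] (h : GeOne T) (hT : IsSelfAdjoint T) :
    ∃ R : H →L[ℂ] H, IsSelfAdjoint R ∧ (∀ y, ‖R y‖ ≤ ‖y‖) ∧ IsBoundedInverse T R := by
  have hadj := LinearPMap.isSelfAdjoint_def.1 hT
  have hsymm : T.IsFormalAdjoint T := by
    have := LinearPMap.adjoint_isFormalAdjoint hT.dense_domain
    rwa [hadj] at this
  have hle : ∀ p ∈ T.graph, ‖p.1‖ ≤ ‖p.2‖ := by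
    rintro ⟨_, _⟩ hp
    obtain ⟨x, rfl, rfl⟩ := (LinearPMap.mem_graph_iff _).1 hp
    exact h.norm_le x
  -- The product carries the sup norm and `‖x‖ ≤ ‖T x‖`, so `(x, T x) ↦ T x` is isometric; the graph
  -- is complete, hence `ran T` is closed.
  let J : T.graph →ₗᵢ[ℂ] H :=
    { toLinearMap := (LinearMap.snd ℂ H H).comp T.graph.subtype
      norm_map' := fun p => (max_eq_right (hle p.1 p.2)).symm }
  have hG : IsClosed (T.graph : Set (H × H)) := hT.isClosed
  have : CompleteSpace T.graph := hG.completeSpace_coe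
  have hc : IsClosed (LinearMap.range J.toLinearMap : Set H) := by
    rw [LinearMap.coe_range]
    exact J.isometry.isClosedEmbedding.isClosed_range
  have : CompleteSpace (LinearMap.range J.toLinearMap) := hc.completeSpace_coe
  have hrange : LinearMap.range J.toLinearMap = ⊤ := by
    rw [← Submodule.orthogonal_eq_bot_iff, Submodule.eq_bot_iff]
    intro w hw
    -- If `w ⊥ ran T`, then `w ∈ D(T*) = D(T)`, and `‖w‖² ≤ Re ⟨w, T w⟩ = 0`.
    have h0 : ∀ x : T.domain, inner ℂ (0 : H) (x : H) = inner ℂ w (T x) := by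
      intro x
      rw [inner_zero_left, Submodule.inner_left_of_mem_orthogonal _ hw]
      exact ⟨⟨_, T.mem_graph x⟩, rfl⟩
    have hmem := LinearPMap.mem_adjoint_domain_of_exists w ⟨0, h0⟩
    have hw0 : inner ℂ w (T ⟨w, hadj ▸ hmem⟩) = 0 := by rw [← h0, inner_zero_left]
    have := h ⟨w, hadj ▸ hmem⟩
    rw [hw0] at this
    simpa using this
  let e := LinearIsometryEquiv.ofSurjective J (LinearMap.range_eq_top.1 hrange)
  let R : H →L[ℂ] H := (ContinuousLinearMap.fst ℂ H H).comp
    (T.graph.subtypeL.comp (e.symm.toContinuousLinearEquiv : H →L[ℂ] T.graph))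
  have hR : ∀ y, (R y, y) ∈ T.graph := by
    intro y
    have h2 : (e.symm y).1.2 = y := e.apply_symm_apply y
    have h1 := (e.symm y).2
    rw [← Prod.mk.eta (p := (e.symm y).1), h2] at h1
    exact h1
  refine ⟨R, ?_, fun y => hle _ (hR y), fun x y => ⟨fun hxy => ?_, ?_⟩⟩
  · rw [ContinuousLinearMap.isSelfAdjoint_iff_isSymmetric]
    intro y z
    obtain ⟨u, hu, huy⟩ := (LinearPMap.mem_graph_iff _).1 (hR y)
    obtain ⟨v, hv, hvz⟩ := (LinearPMap.mem_graph_iff _).1 (hR z)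
    dsimp only at hu huy hv hvz
    have := hsymm u v
    rw [hu, huy, hv, hvz] at this
    exact this.symm
  · have := hle _ (T.graph.sub_mem (hR y) hxy)
    simp only [Prod.fst_sub, Prod.snd_sub, sub_self, norm_zero, norm_le_zero_iff] at this
    exact sub_eq_zero.1 this
  · rintro rfl
    exact hR y

end Existence

/-! ### From bounds on a core to inclusion of domains -/

theorem domain_le_of_hasCore [CompleteSpace H] {S T : H →ₗ.[ℂ] H} {D : Submodule ℂ H}
    (hS : S.IsClosed) (hT : T.IsClosed) (hD : T.HasCore D) {C : ℝ}
    (hDS : D ≤ S.domain)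
    (hC : ∀ x y z, (x, y) ∈ S.graph → (x, z) ∈ T.graph → ‖y‖ ≤ C * ‖z‖) :
    T.domain ≤ S.domain := by
  intro x hx
  have hcl : (T.domRestrict D).IsClosable :=
    hT.isClosable.leIsClosable LinearPMap.domRestrict_le
  obtain ⟨z, hmem⟩ := LinearPMap.mem_domain_iff.1 hx
  rw [← hD.closure_eq, ← hcl.graph_closure_eq_closure_graph, ← SetLike.mem_coe,
    Submodule.topologicalClosure_coe, mem_closure_iff_seq_limit] at hmem
  obtain ⟨p, hp, hlim⟩ := hmem
  have hpT : ∀ n, p n ∈ T.graph := fun n => LinearPMap.le_graph_of_le LinearPMap.domRestrict_le (hp n)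
  have hpS : ∀ n, ∃ y, ((p n).1, y) ∈ S.graph := fun n => by
    obtain ⟨u, hu, -⟩ := (LinearPMap.mem_graph_iff _).1 (hp n)
    exact LinearPMap.mem_domain_iff.1 (hDS (hu ▸ u.2.1))
  choose y hy using hpS
  have hcauchy : CauchySeq y := by
    have h2 := (hlim.snd_nhds.cauchySeq)
    rw [cauchySeq_iff_tendsto_dist_atTop_0] at h2 ⊢
    refine squeeze_zero (fun _ => dist_nonneg) (fun n => ?_) (by simpa using h2.const_mul C)
    rw [dist_eq_norm, dist_eq_norm]
    exact hC _ _ _ (S.graph.sub_mem (hy n.1) (hy n.2)) (T.graph.sub_mem (hpT n.1) (hpT n.2))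
  obtain ⟨y₀, hy₀⟩ := cauchySeq_tendsto_of_complete hcauchy
  have : (x, y₀) ∈ S.graph :=
    IsClosed.mem_of_tendsto hS (hlim.fst_nhds.prodMk_nhds hy₀) (Eventually.of_forall hy)
  exact LinearPMap.mem_domain_iff.2 ⟨_, this⟩

theorem smoothDomain_le_of_isBoundedOp [CompleteSpace H] {S T : H →ₗ.[ℂ] H} {P Q : H →L[ℂ] H}
    (hS : IsBoundedInverse S P) (hT : IsBoundedInverse T Q) {D : Submodule ℂ H}
    (hD : D ≤ smoothDomain S) (hcore : ∀ n, 1 ≤ n → (pow T n).HasCore D)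
    (hb : ∀ k, 1 ≤ k → ∃ l, 1 ≤ l ∧ IsBoundedOp (prod (pow S k) (negPow T l))) :
    smoothDomain T ≤ smoothDomain S := by
  refine hT.smoothDomain_le fun k hk => ?_
  obtain ⟨l, hl, C, hC⟩ := hb k hk
  refine ⟨l, domain_le_of_hasCore (hS.pow k).isClosed (hT.pow l).isClosed (hcore l hl) (C := C)
    (fun x hx => (hS.pow k).mem_domain_iff.2 (hS.mem_smoothDomain_iff.1 (hD hx) k))
    fun x y z hy hz => ?_⟩
  have hzy : (z, y) ∈ (prod (pow S k) (negPow T l)).graph :=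
    mem_prod_graph.2 ⟨x, (hT.pow l).mem_inverse_graph_iff.2 (((hT.pow l) _ _).1 hz), hy⟩
  obtain ⟨u, hu, huy⟩ := (LinearPMap.mem_graph_iff _).1 hzy
  dsimp only at hu huy
  rw [← hu, ← huy]
  exact hC u

/-! ### Density of `D^∞` by smooth spectral cut-offs -/

theorem continuous_inv_pow_mul_expNegInvGlue (n : ℕ) :
    Continuous fun t : ℝ => t⁻¹ ^ n * expNegInvGlue t := by
  simpa using expNegInvGlue.continuous_polynomial_eval_inv_mul (Polynomial.X ^ n)

/-- With `s = (c t)²`, `1 - exp(-1/s)` is at most `1` and at most `1/s`; the first bound serves for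
`|t| ≤ 1/c`, the second beyond. -/
theorem abs_sub_mul_expNegInvGlue_le {c : ℝ} (hc : 0 < c) (t : ℝ) :
    |t - t * expNegInvGlue ((c * t) ^ 2)| ≤ c⁻¹ := by
  rcases eq_or_ne t 0 with rfl | ht
  · simpa using hc.le
  have hpos : 0 < (c * t) ^ 2 := by positivity
  have h0 : 0 ≤ 1 - expNegInvGlue ((c * t) ^ 2) := by
    simp [expNegInvGlue, hpos.not_ge]
    positivity
  have h1 : 1 - expNegInvGlue ((c * t) ^ 2) ≤ 1 := by
    linarith [expNegInvGlue.nonneg ((c * t) ^ 2)]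
  have h2 : 1 - expNegInvGlue ((c * t) ^ 2) ≤ ((c * t) ^ 2)⁻¹ := by
    rw [expNegInvGlue, if_neg hpos.not_ge]
    linarith [Real.add_one_le_exp (-((c * t) ^ 2)⁻¹)]
  have h3 : |t - t * expNegInvGlue ((c * t) ^ 2)| = |t| * (1 - expNegInvGlue ((c * t) ^ 2)) := by
    rw [← mul_one_sub, abs_mul, abs_of_nonneg h0]
  have ht' : 0 < |t| := abs_pos.2 ht
  rw [h3]
  rcases le_total |t| c⁻¹ with h | h
  · exact (mul_le_of_le_one_right ht'.le h1).trans h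
  · calc |t| * (1 - expNegInvGlue ((c * t) ^ 2)) ≤ |t| * ((c * t) ^ 2)⁻¹ := by gcongr
      _ = c⁻¹ * (c⁻¹ * |t|⁻¹) := by
        rw [← sq_abs, abs_mul, abs_of_pos hc]; field_simp
      _ ≤ c⁻¹ * (|t| * |t|⁻¹) := by gcongr
      _ = c⁻¹ := by rw [mul_inv_cancel₀ ht'.ne', mul_one]

variable [CompleteSpace H]

theorem denseRange_of_isSelfAdjoint_of_injective {R : H →L[ℂ] H} (hR : IsSelfAdjoint R)
    (hinj : Function.Injective R) : DenseRange R := by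
  have h := ContinuousLinearMap.orthogonal_range R
  rw [hR.adjoint_eq, LinearMap.ker_eq_bot.2 hinj] at h
  have := Submodule.topologicalClosure_eq_top_iff.2 h
  rwa [← Submodule.dense_iff_topologicalClosure_eq_top] at this

/-- The cut-offs `g m` vanish to infinite order at `0`, so `g m (R)` maps into every `ran Rⁿ`, while
`g m (R) R → R` in norm and `ran R` is dense. -/
theorem dense_setOf_forall_mem_range_pow {R : H →L[ℂ] H} (hR : IsSelfAdjoint R)
    (hinj : Function.Injective R) : Dense {x : H | ∀ n, ∃ y, (R ^ n) y = x} := by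
  set g : ℕ → ℝ → ℝ := fun m t => expNegInvGlue (((m + 1 : ℝ) * t) ^ 2) with hg
  have hgc : ∀ m, Continuous (g m) := fun m =>
    (expNegInvGlue.contDiff (n := 0)).continuous.comp (by fun_prop)
  have hfac : ∀ m n, ∃ Q : H →L[ℂ] H, cfc (g m) R = R ^ n * Q := by
    intro m n
    -- This is `t⁻ⁿ g m t`, rewritten through `s = ((m + 1) t)²` so that continuity at `0` comes
    -- from that of `s⁻ⁿ exp(-1/s)`.
    let k : ℝ → ℝ := fun t => ((m + 1 : ℝ) ^ (2 * n) * t ^ n) *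
      (((((m + 1 : ℝ) * t) ^ 2)⁻¹) ^ n * expNegInvGlue (((m + 1 : ℝ) * t) ^ 2))
    have hk : Continuous k := Continuous.mul (by fun_prop)
      ((continuous_inv_pow_mul_expNegInvGlue n).comp
        (g := fun t : ℝ => t⁻¹ ^ n * expNegInvGlue t) (by fun_prop))
    refine ⟨cfc k R, ?_⟩
    rw [← cfc_pow_id (R := ℝ) R n, ← cfc_mul _ _ R (by fun_prop) hk.continuousOn]
    congr 1
    funext t
    rcases eq_or_ne t 0 with rfl | ht
    · simp [hg, k]
    · have h1 : ((m + 1 : ℝ) ^ (2 * n) * t ^ n) * t ^ n = (((m + 1 : ℝ) * t) ^ 2) ^ n := by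
        rw [mul_pow, mul_pow, ← pow_mul, ← pow_mul, mul_assoc, ← pow_add, two_mul]
      simp only [hg, k]
      rw [← mul_assoc, ← mul_assoc, mul_comm (t ^ n), h1, ← mul_pow,
        mul_inv_cancel₀ (by positivity), one_pow, one_mul]
  have hlim : ∀ y, Tendsto (fun m => cfc (g m) R (R y)) atTop (𝓝 (R y)) := by
    intro y
    rw [tendsto_iff_norm_sub_tendsto_zero]
    refine squeeze_zero (fun _ => norm_nonneg _) (fun m => ?_)
      (g := fun m : ℕ => 1 / (m + 1 : ℝ) * ‖y‖)
      (by simpa using (tendsto_one_div_add_atTop_nhds_zero_nat (𝕜 := ℝ)).mul_const ‖y‖)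
    have hop : R - cfc (g m) R * R = cfc (fun t : ℝ => t - g m t * t) R := by
      have := hgc m
      rw [cfc_sub _ _ R (by fun_prop) (by fun_prop), cfc_mul _ _ R (by fun_prop) (by fun_prop),
        cfc_id' ℝ R]
    have hn : ‖R - cfc (g m) R * R‖ ≤ (m + 1 : ℝ)⁻¹ := by
      rw [hop]
      exact norm_cfc_le (by positivity)
        fun t _ => by
          rw [mul_comm]; exact abs_sub_mul_expNegInvGlue_le (by positivity) t
    rw [norm_sub_rev, one_div]
    exact (ContinuousLinearMap.le_opNorm (R - cfc (g m) R * R) y).trans (by gcongr)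
  refine dense_iff_closure_eq.2 (Set.eq_univ_of_forall fun x => ?_)
  refine closure_minimal ?_ isClosed_closure (denseRange_of_isSelfAdjoint_of_injective hR hinj x)
  rintro _ ⟨y, rfl⟩
  refine mem_closure_of_tendsto (hlim y) (Eventually.of_forall fun m n => ?_)
  obtain ⟨Q, hQ⟩ := hfac m n
  exact ⟨Q (R y), by rw [hQ]; rfl⟩

/-! ### The Baire category estimate -/

theorem exists_norm_inner_le {P Q : H →L[ℂ] H} (hP : IsSelfAdjoint P)
    (hQinj : Function.Injective Q) (hQ : ∀ y, ‖Q y‖ ≤ ‖y‖)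
    (hQP : ∀ x, (∀ n, ∃ y, (Q ^ n) y = x) → ∃ y, P y = x) :
    ∃ N : ℕ, ∃ C : ℝ, ∀ y, (∀ n, ∃ z, (Q ^ n) z = y) → ∀ w,
      ‖inner ℂ w ((Q ^ N) y)‖ ≤ C * ‖y‖ * ‖P w‖ := by
  -- `D^∞` as a projective limit: `x n` plays the role of `Q⁻ⁿ (x 0)`. Being closed in `ℕ → H`, it
  -- is a Baire space.
  let X : Submodule ℂ (ℕ → H) :=
    { carrier := {x | ∀ n, Q (x (n + 1)) = x n}
      zero_mem' := by simp
      add_mem' := fun hx hy n => by simp [hx n, hy n]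
      smul_mem' := fun c x hx n => by simp [hx n] }
  have hXc : IsClosed (X : Set (ℕ → H)) := by
    have : (X : Set (ℕ → H)) = ⋂ n, {x | Q (x (n + 1)) = x n} := by
      ext x; simp [X]
    rw [this]
    exact isClosed_iInter fun n => isClosed_eq (by fun_prop) (by fun_prop)
  have hpow : ∀ x ∈ X, ∀ n j, (Q ^ n) (x (j + n)) = x j := by
    intro x hx n
    induction n with
    | zero => simp
    | succ n ih =>
      intro j
      rw [pow_succ, mul_apply_eq_comp, ← add_assoc, hx, ih]
  have := hXc.isCompletelyPseudoMetrizableSpace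
  have : BaireSpace X := inferInstanceAs (BaireSpace (X : Set (ℕ → H)))
  let F : ℕ → Set X := fun C => {x | ∀ w, ‖inner ℂ w (x.1 0)‖ ≤ C * ‖P w‖}
  have hF : ∀ C, IsClosed (F C) := fun C => by
    simp only [F, Set.ofPred_forall]
    exact isClosed_iInter fun w => isClosed_le
      (continuous_const.inner ((continuous_apply 0).comp continuous_subtype_val)).norm
      continuous_const
  have hcover : ⋃ C, F C = Set.univ := by
    refine Set.eq_univ_of_forall fun x => ?_
    obtain ⟨u, hu⟩ := hQP (x.1 0) fun n => ⟨x.1 (0 + n), hpow x.1 x.2 n 0⟩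
    obtain ⟨C, hC⟩ := exists_nat_ge ‖u‖
    refine Set.mem_iUnion.2 ⟨C, fun w => ?_⟩
    rw [← hu, ← ContinuousLinearMap.adjoint_inner_left, hP.adjoint_eq, mul_comm]
    exact (norm_inner_le_norm _ _).trans (by gcongr)
  obtain ⟨C, p, hp⟩ := nonempty_interior_of_iUnion_of_closed hF hcover
  have hnhds : ∀ᶠ z in 𝓝 (0 : X), p + z ∈ F C := by
    have : Tendsto (fun z : X => p + z) (𝓝 0) (𝓝 p) := by
      simpa using (tendsto_const_nhds (x := p)).add (tendsto_id (x := 𝓝 (0 : X)))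
    exact this.eventually (mem_interior_iff_mem_nhds.1 hp)
  -- A basic neighbourhood restricts finitely many coordinates; since `Q` is a contraction, the one
  -- of largest index controls the others.
  have hbasis : ∃ N : ℕ, ∃ ε > 0, ∀ z : X, ‖z.1 N‖ < ε → p + z ∈ F C := by
    have hB := (Metric.nhds_basis_ball (x := (0 : H))).pi_self (ι := ℕ)
    have hpi : 𝓝 ((0 : X) : ℕ → H) = Filter.pi fun _ => 𝓝 (0 : H) := nhds_pi
    rw [nhds_subtype_eq_comap, hpi] at hnhds
    obtain ⟨⟨I, ε⟩, ⟨hI, hε⟩, hsub⟩ := (hB.comap _).eventually_iff.1 hnhds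
    obtain ⟨N, hN⟩ := hI.bddAbove
    refine ⟨N, ε, hε, fun z hz => hsub fun i hi => ?_⟩
    obtain ⟨n, rfl⟩ := Nat.exists_eq_add_of_le (hN hi)
    have hQn : ∀ n y, ‖(Q ^ n) y‖ ≤ ‖y‖ := by
      intro n
      induction n with
      | zero => simp
      | succ n ih => exact fun y => (ih (Q y)).trans (hQ y)
    rw [mem_ball_zero_iff, ← hpow z.1 z.2 n i]
    exact (hQn _ _).trans_lt hz
  obtain ⟨N, ε, hε, hN⟩ := hbasis
  have hpF : p ∈ F C := interior_subset hp
  have hz : ∀ z : X, ‖z.1 N‖ < ε → ∀ w, ‖inner ℂ w (z.1 0)‖ ≤ 2 * C * ‖P w‖ := by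
    intro z hz w
    have h1 := hN z hz w
    have h2 := hpF w
    have h3 : inner ℂ w (z.1 0) = inner ℂ w ((p + z).1 0) - inner ℂ w (p.1 0) := by
      simp
    rw [h3]
    linarith [norm_sub_le (inner ℂ w ((p + z).1 0)) (inner ℂ w (p.1 0))]
  have hpinj : ∀ n : ℕ, Function.Injective ⇑(Q ^ n) := by
    intro n
    induction n with
    | zero => exact Function.injective_id
    | succ n ih => exact ih.comp hQinj
  refine ⟨N, 2 * C * (2 / ε), fun y hy w => ?_⟩
  rcases eq_or_ne y 0 with rfl | hy0
  · simp
  choose u hu using hy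
  have hu0 : u 0 = y := hu 0
  have hQu : ∀ n, Q (u (n + 1)) = u n := fun n => hpinj n (by
    rw [hu n, ← hu (n + 1), pow_succ, mul_apply_eq_comp])
  -- The test sequence `z n = c Q^N (u n)` has `z 0 = c Q^N y` and `z N = c y`, of norm `ε / 2`.
  let c : ℝ := ε / (2 * ‖y‖)
  have hypos : 0 < ‖y‖ := norm_pos_iff.2 hy0
  have hc : 0 < c := by positivity
  let z : X := (c : ℂ) • ⟨fun n => (Q ^ N) (u n), fun n => by
    change Q ((Q ^ N) (u (n + 1))) = (Q ^ N) (u n)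
    rw [← hQu n, ← mul_apply_eq_comp, ← mul_apply_eq_comp, ← pow_succ, ← pow_succ']⟩
  have hzN : z.1 N = (c : ℂ) • y := congrArg ((c : ℂ) • ·) (hu N)
  have hz0 : z.1 0 = (c : ℂ) • (Q ^ N) y := congrArg (fun v => (c : ℂ) • (Q ^ N) v) hu0
  have hlt : ‖z.1 N‖ < ε := by
    rw [hzN, norm_smul, Complex.norm_real, Real.norm_of_nonneg hc.le]
    simp only [c]
    field_simp
    linarith
  have h1 := hz z hlt w
  rw [hz0, inner_smul_right, norm_mul, Complex.norm_real, Real.norm_of_nonneg hc.le,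
    mul_comm, ← le_div_iff₀ hc] at h1
  refine h1.trans (le_of_eq ?_)
  simp only [c]
  field_simp

/-! ### Factorisation and conclusion -/

/-- Taking `y = S w` gives `‖S w‖ ≤ |C| ‖P w‖`, so `P w ↦ S w` extends from the dense range of `P`
to a bounded operator; the adjoint of that extension is the factor. -/
theorem exists_eq_mul_of_norm_inner_le {P S : H →L[ℂ] H} (hP : IsSelfAdjoint P)
    (hPinj : Function.Injective P) (hS : IsSelfAdjoint S) {D : Set H} (hD : Dense D) {C : ℝ}
    (h : ∀ y ∈ D, ∀ w, ‖inner ℂ w (S y)‖ ≤ C * ‖y‖ * ‖P w‖) :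
    ∃ T : H →L[ℂ] H, S = P * T := by
  have h1 : ∀ y w, ‖inner ℂ w (S y)‖ ≤ C * ‖y‖ * ‖P w‖ := by
    intro y w
    have : IsClosed {y | ‖inner ℂ w (S y)‖ ≤ C * ‖y‖ * ‖P w‖} :=
      isClosed_le (by fun_prop) (by fun_prop)
    exact this.closure_subset_iff.2 (fun y hy => h y hy w) (hD y)
  have h2 : ∀ w, ‖S w‖ ≤ |C| * ‖P w‖ := by
    intro w
    rcases eq_or_ne (S w) 0 with h0 | h0
    · rw [h0, norm_zero]
      positivity
    · have h3 := h1 (S w) w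
      rw [← ContinuousLinearMap.adjoint_inner_left, hS.adjoint_eq, inner_self_eq_norm_sq_to_K,
        norm_pow, RCLike.norm_ofReal, abs_norm] at h3
      have : 0 < ‖S w‖ := norm_pos_iff.2 h0
      refine le_of_mul_le_mul_right ?_ this
      calc ‖S w‖ * ‖S w‖ = ‖S w‖ ^ 2 := (sq _).symm
        _ ≤ C * ‖S w‖ * ‖P w‖ := h3
        _ ≤ |C| * ‖S w‖ * ‖P w‖ := by gcongr; exact le_abs_self C
        _ = |C| * ‖P w‖ * ‖S w‖ := by ring
  have hd := denseRange_of_isSelfAdjoint_of_injective hP hPinj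
  let T := LinearMap.extendOfNorm S.toLinearMap P.toLinearMap
  have hT : T * P = S := by
    ext w
    exact LinearMap.extendOfNorm_eq (f := S.toLinearMap) (e := P.toLinearMap) hd ⟨|C|, h2⟩ w
  refine ⟨star T, ?_⟩
  rw [← hS.star_eq, ← hT, star_mul, hP.star_eq]

theorem exists_domain_eq_top_and_isBoundedOp {S T : H →ₗ.[ℂ] H} {P Q : H →L[ℂ] H}
    (hS : IsBoundedInverse S P) (hT : IsBoundedInverse T Q) (hP : IsSelfAdjoint P)
    (hQ : IsSelfAdjoint Q) (hQ1 : ∀ y, ‖Q y‖ ≤ ‖y‖) (h : smoothDomain T ≤ smoothDomain S) (k : ℕ) :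
    ∃ l, 1 ≤ l ∧ (prod (pow S k) (negPow T l)).domain = ⊤ ∧
      IsBoundedOp (prod (pow S k) (negPow T l)) := by
  obtain ⟨N, C, hC⟩ := exists_norm_inner_le (hP.pow k) hT.injective hQ1
    fun x hx => hS.mem_smoothDomain_iff.1 (h (hT.mem_smoothDomain_iff.2 hx)) k
  obtain ⟨V, hV⟩ := exists_eq_mul_of_norm_inner_le (hP.pow k) (hS.pow k).injective (hQ.pow N)
    (dense_setOf_forall_mem_range_pow hQ hT.injective) hC
  have hgraph : ∀ y, (y, V (Q y)) ∈ (prod (pow S k) (negPow T (N + 1))).graph := fun y =>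
    mem_prod_graph.2 ⟨(Q ^ (N + 1)) y, (hT.pow _).mem_inverse_graph_iff.2 rfl,
      (hS.pow k _ _).2 (by rw [pow_succ, hV]; rfl)⟩
  -- `N` may be `0`; the extra factor `Q` secures an exponent at least `1`.
  refine ⟨N + 1, by lia, ?_, ‖V * Q‖, fun y => ?_⟩
  · exact Submodule.eq_top_iff'.2 fun y => LinearPMap.mem_domain_of_mem_graph (hgraph y)
  · have := LinearPMap.mem_graph_snd_inj _ (LinearPMap.mem_graph _ y) (hgraph y) rfl
    rw [this]
    exact (V * Q).le_opNorm y

end UnboundedOp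

theorem mainTheorem9 {H : Type*} [NormedAddCommGroup H] [InnerProductSpace ℂ H] [CompleteSpace H]
    (A B : H →ₗ.[ℂ] H) (hA : IsSelfAdjoint A) (hB : IsSelfAdjoint B)
    (hA1 : UnboundedOp.GeOne A) (hB1 : UnboundedOp.GeOne B) :
    (UnboundedOp.smoothDomain A = UnboundedOp.smoothDomain B →
      (∀ k : ℕ, 1 ≤ k → ∃ l : ℕ, 1 ≤ l ∧
        (UnboundedOp.prod (UnboundedOp.pow A k) (UnboundedOp.negPow B l)).domain = ⊤ ∧
        UnboundedOp.IsBoundedOp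
          (UnboundedOp.prod (UnboundedOp.pow A k) (UnboundedOp.negPow B l))) ∧
      (∀ h : ℕ, 1 ≤ h → ∃ m : ℕ, 1 ≤ m ∧
        (UnboundedOp.prod (UnboundedOp.pow B h) (UnboundedOp.negPow A m)).domain = ⊤ ∧
        UnboundedOp.IsBoundedOp
          (UnboundedOp.prod (UnboundedOp.pow B h) (UnboundedOp.negPow A m)))) ∧
    ((∃ D₀ : Submodule ℂ H,
        D₀ ≤ UnboundedOp.smoothDomain A ⊓ UnboundedOp.smoothDomain B ∧
        UnboundedOp.IsCommonCore A B D₀) →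
      (∀ k : ℕ, 1 ≤ k → ∃ l : ℕ, 1 ≤ l ∧
        UnboundedOp.IsBoundedOp
          (UnboundedOp.prod (UnboundedOp.pow A k) (UnboundedOp.negPow B l))) →
      (∀ h : ℕ, 1 ≤ h → ∃ m : ℕ, 1 ≤ m ∧
        UnboundedOp.IsBoundedOp
          (UnboundedOp.prod (UnboundedOp.pow B h) (UnboundedOp.negPow A m))) →
      UnboundedOp.smoothDomain A = UnboundedOp.smoothDomain B) := by
  obtain ⟨P, hP, hP1, hPA⟩ := hA1.exists_isBoundedInverse hA
  obtain ⟨Q, hQ, hQ1, hQB⟩ := hB1.exists_isBoundedInverse hB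
  refine ⟨fun h => ⟨fun k _ => ?_, fun k _ => ?_⟩, ?_⟩
  · exact UnboundedOp.exists_domain_eq_top_and_isBoundedOp hPA hQB hP hQ hQ1 h.ge k
  · exact UnboundedOp.exists_domain_eq_top_and_isBoundedOp hQB hPA hQ hP hP1 h.le k
  · rintro ⟨D, hD, hcore⟩ h1 h2
    exact le_antisymm
      (UnboundedOp.smoothDomain_le_of_isBoundedOp hQB hPA (hD.trans inf_le_right)
        (fun n hn => (hcore n hn).1) h2)
      (UnboundedOp.smoothDomain_le_of_isBoundedOp hPA hQB (hD.trans inf_le_left)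
        (fun n hn => (hcore n hn).2) h1)
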